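/- **Definitions.** Let $w=(w_{ij})$ be a symmetric matrix of non-negative similarities on $V=\{1,\dots,n\}$; an unweighted graph $G$ is identified with its $0/1$ adjacency matrix. A hierarchical clustering tree (HC-tree) is a finite rooted tree $T$ whose leaf set is $V$. For distinct $i,j,k$ say that $\{i,j\mid k\}$ holds in $T$ if the lowest common ancestor of $i,j$ is a proper descendant of the lowest common ancestor of $i,j,k$. The cost of a triplet $\{i,j,k\}$ in $T$ is $w_{ik}+w_{jk}$ if $\{i,j\mid k\}$ holds (and similarly for $\{i,k\mid j\}$ and $\{j,k\mid i\}$), and $w_{ij}+w_{jk}+w_{ik}$ if none of these three relations holds. Let $\mathrm{totalC}_G(T)$ be the sum of the costs of all (unordered) triplets of distinct elements of $V$, let $\mathrm{baseC}(G)=\sum_{\{i,j,k\}}\min\{w_{ij}+w_{ik},\,w_{ij}+w_{jk},\,w_{ik}+w_{jk}\}$, let $\rho_G(T)=\mathrm{totalC}_G(T)/\mathrm{baseC}(G)$ (with $0/0=1$ and $x/0=+\infty$ for $x>0$), and let $\rho^*_G=\min_T\rho_G(T)$ over all HC-trees $T$. In the planted bisection model $G(n,p,q)$, with $0\le q<p\le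 1$, every pair $i\neq j$ of vertices in $\{1,\dots,n\}$ is an edge independently, with probability $p$ if $i,j\le n/2$ or $i,j>n/2$, and with probability $q$ otherwise. Put $$F(p,q)=\frac{2p+6q}{3(p+q)^2-p^3-3pq^2}.$$ **Corollary.** (a) There is a constant $\varepsilon>0$ such that, for all sequences $p=p_n$, $q=q_n$ in $[0,1]$ with $p_n>q_n$ for every $n$ and $q_n=\omega\left(\sqrt{\log n/n}\right)$, there is a sequence $\delta_n\to0$ such that, for all sufficiently large $n$, the random graph $G=G(n,p_n,q_n)$ satisfies $$(1-\delta_n)\,F(p_n,q_n)\le\rho^*_G\le(1+\delta_n)\,F(p_n,q_n)$$ with probability larger than $1-n^{-\varepsilon}$. That is, with high probability $\rho^*_G=(1+o(1))F(p,q)$. (b) The value $F$ decreases in $p$: for every $0\le q<1$, the function $p\mapsto F(p,q)$ is strictly decreasing on $(q,1]$. (c) For every $0<p<1$, the function $q\mapsto F(p,q)$ is strictly increasing on $[0,p/3)$ and strictly decreasing on $[p/3,p)$. For $p=1$ it is constant: $F(1,q)=1$ for all $0\le q<1$. -/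

import Mathlib

open Filter Topology MeasureTheory ProbabilityTheory Asymptotics
open scoped unitInterval

noncomputable section

/-! ### Hierarchical clustering trees and their costs -/

/-- A hierarchical clustering tree on the data set `V`: a finite rooted tree whose set of leaves is
(identified with) `V`. Nodes are ordered by ancestorship, so that the root is `⊥`, the leaves are
the maximal nodes and the lowest common ancestor of `a` and `b` is `a ⊓ b`. Nodes may have any
number of children. -/
structure HCTree (V : Type) where
  tree : RootedTree.{0}
  finite_nodes : Finite tree
  leaf : V → tree
  leaf_injective : Function.Injective leaf
  range_leaf : Set.range leaf = {x : tree | IsMax x}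

namespace HCTree

variable {V : Type}

/-- The lowest common ancestor of the leaves `i` and `j`. -/
def lca (T : HCTree V) (i j : V) : T.tree := T.leaf i ⊓ T.leaf j

/-- The lowest common ancestor of the leaves `i`, `j` and `k`. -/
def lca₃ (T : HCTree V) (i j k : V) : T.tree := T.leaf i ⊓ T.leaf j ⊓ T.leaf k

/-- The relation `{i, j | k}`: the lowest common ancestor of `i, j` is a proper descendant of the
lowest common ancestor of `i, j, k`. -/
def MergesFirst (T : HCTree V) (i j k : V) : Prop := T.lca₃ i j k < T.lca i j

open Classical in
/-- The cost of the triplet `{i, j, k}` induced by `T`, for the similarities `w`. In the last case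
none of the three pairs merges before the triplet, i.e. all three merge at the same node. -/
def tripletCost (T : HCTree V) (w : V → V → ℝ) (i j k : V) : ℝ :=
  if T.MergesFirst i j k then w i k + w j k
  else if T.MergesFirst i k j then w i j + w j k
  else if T.MergesFirst j k i then w i j + w i k
  else w i j + w j k + w i k

end HCTree

/-- The triplets of distinct indices, each listed once, in increasing order. -/
def triplets (n : ℕ) : Finset (Fin n × Fin n × Fin n) :=
  Finset.univ.filter fun t => t.1 < t.2.1 ∧ t.2.1 < t.2.2

/-- The total cost of the tree `T`. -/
def totalCost {n : ℕ} (w : Fin n → Fin n → ℝ) (T : HCTree (Fin n)) : ℝ :=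
  ∑ t ∈ triplets n, T.tripletCost w t.1 t.2.1 t.2.2

/-- The least cost that a triplet can have. -/
def minTripletCost {V : Type} (w : V → V → ℝ) (i j k : V) : ℝ :=
  min (w i j + w i k) (min (w i j + w j k) (w i k + w j k))

/-- The base cost of the similarities `w`. -/
def baseCost {n : ℕ} (w : Fin n → Fin n → ℝ) : ℝ :=
  ∑ t ∈ triplets n, minTripletCost w t.1 t.2.1 t.2.2

/-- The ratio cost `totalCost / baseCost`, with the conventions `0 / 0 = 1` and `x / 0 = +∞` for
`x > 0`. -/
def ratioCost {n : ℕ} (w : Fin n → Fin n → ℝ) (T : HCTree (Fin n)) : EReal :=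
  if baseCost w = 0 then (if totalCost w T = 0 then 1 else ⊤)
  else ((totalCost w T / baseCost w : ℝ) : EReal)

/-- The optimal ratio cost: the least ratio cost of a hierarchical clustering tree
(a minimum, see `exists_ratioCost_eq_optRatioCost`). -/
def optRatioCost {n : ℕ} (w : Fin n → Fin n → ℝ) : EReal :=
  ⨅ T : HCTree (Fin n), ratioCost w T

/-- The optimal ratio cost is attained (as soon as there is a tree at all). -/
theorem exists_ratioCost_eq_optRatioCost {n : ℕ} (w : Fin n → Fin n → ℝ)
    [Nonempty (HCTree (Fin n))] :
    ∃ T : HCTree (Fin n), ratioCost w T = optRatioCost w := by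
  classical
  have hfin : (Set.range (ratioCost w)).Finite := by
    let f : (Fin n → Fin n → Fin n → Prop) → EReal := fun R =>
      let c : ℝ := ∑ t ∈ triplets n,
        if R t.1 t.2.1 t.2.2 then w t.1 t.2.2 + w t.2.1 t.2.2
        else if R t.1 t.2.2 t.2.1 then w t.1 t.2.1 + w t.2.1 t.2.2
        else if R t.2.1 t.2.2 t.1 then w t.1 t.2.1 + w t.1 t.2.2
        else w t.1 t.2.1 + w t.2.1 t.2.2 + w t.1 t.2.2
      if baseCost w = 0 then (if c = 0 then 1 else ⊤) else ((c / baseCost w : ℝ) : EReal)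
    refine (Set.finite_range f).subset ?_
    rintro _ ⟨T, rfl⟩
    refine ⟨T.MergesFirst, ?_⟩
    simp only [f, ratioCost, totalCost, HCTree.tripletCost]
    congr!
  exact (Set.range_nonempty _).csInf_mem hfin

/-! ### Random graphs -/

open Classical in
/-- The similarities of an unweighted graph: every edge has weight `1`, non-edges weight `0`. -/
def unitWeight {V : Type} (G : SimpleGraph V) (i j : V) : ℝ := if G.Adj i j then 1 else 0

/-- The pairs `i < j` of vertices, i.e. the potential edges. -/
abbrev VertexPair (n : ℕ) : Type := {e : Fin n × Fin n // e.1 < e.2}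

/-- The graph whose edges are the pairs at which `ω` holds. -/
def graphOfPairs {n : ℕ} (ω : VertexPair n → Prop) : SimpleGraph (Fin n) where
  Adj i j := (∃ h : i < j, ω ⟨(i, j), h⟩) ∨ (∃ h : j < i, ω ⟨(j, i), h⟩)
  symm := ⟨fun _ _ h => h.symm⟩
  loopless := ⟨fun _ h => h.elim (fun ⟨h, _⟩ => lt_irrefl _ h) (fun ⟨h, _⟩ => lt_irrefl _ h)⟩

/-- The law of the random graph generated from the (symmetric) edge probability matrix `P`: each
pair `i < j` is an edge with probability `P i j`, independently of the other pairs. -/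
def randomGraph {n : ℕ} (P : Fin n → Fin n → I) : Measure (SimpleGraph (Fin n)) :=
  (Measure.pi fun e : VertexPair n => bernoulliMeasure True False (P e.1.1 e.1.2)).map graphOfPairs

/-- `graphOfPairs` is measurable, so that `randomGraph` is a genuine push-forward. -/
theorem measurable_graphOfPairs {n : ℕ} : Measurable (graphOfPairs (n := n)) := by
  exact measurable_of_countable _

instance {n : ℕ} (P : Fin n → Fin n → I) : IsProbabilityMeasure (randomGraph P) :=
  Measure.isProbabilityMeasure_map measurable_graphOfPairs.aemeasurable

/-- The edge probability matrix of the planted bisection model: probability `p` within each of the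
clusters `{1, …, ⌊n/2⌋}` and `{⌊n/2⌋ + 1, …, n}`, and probability `q` across. The vertex with
number `v ∈ {1, …, n}` is the element `v - 1` of `Fin n`. -/
def plantedBisection (n : ℕ) (p q : I) (i j : Fin n) : I :=
  if (2 * (i.val + 1) ≤ n ↔ 2 * (j.val + 1) ≤ n) then p else q

/-- The limiting value of the optimal ratio cost in the planted bisection model. -/
def bisectionValue (p q : ℝ) : ℝ :=
  (2 * p + 6 * q) / (3 * (p + q) ^ 2 - p ^ 3 - 3 * p * q ^ 2)

end

lemma bisectionValue_denom_pos {p q : ℝ} (hp : 0 < p) (hp1 : p ≤ 1) (hq : 0 ≤ q) :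
    0 < 3 * (p + q) ^ 2 - p ^ 3 - 3 * p * q ^ 2 := by
  have h1 : 0 < p ^ 2 * (3 - p) := by have : 0 < 3 - p := by linarith
                                      positivity
  have h2 : 0 ≤ q ^ 2 * (1 - p) := mul_nonneg (sq_nonneg q) (by linarith)
  have h3 : 0 ≤ p * q := mul_nonneg hp.le hq
  linarith

lemma bisectionValue_strictAntiOn_left {q : ℝ} (hq : 0 ≤ q) :
    StrictAntiOn (fun p => bisectionValue p q) (Set.Ioc q 1) := by
  rintro x ⟨hqx, hx1⟩ y ⟨hqy, hy1⟩ hxy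
  have hx : 0 < x := hq.trans_lt hqx
  have hy : 0 < y := hq.trans_lt hqy
  simp only [bisectionValue]
  rw [div_lt_div_iff₀ (bisectionValue_denom_pos hy hy1 hq) (bisectionValue_denom_pos hx hx1 hq)]
  have hxx : x ^ 2 ≤ x := by nlinarith
  have hyy : y ^ 2 ≤ y := by nlinarith
  have hxy' : x * y ≤ x := by nlinarith
  have hqq : q ^ 3 ≤ q ^ 2 := by nlinarith [sq_nonneg q]
  have key : 0 < (3 * x * y - 3 * q ^ 2 - x * y * (x + y)) +
      3 * q * (3 * (x + y) + 6 * q - (x ^ 2 + x * y + y ^ 2) - 3 * q ^ 2) := by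
    have h1 : 0 < x * y * (3 - (x + y)) := by
      have : 0 < 3 - (x + y) := by linarith
      positivity
    have h2 : 0 ≤ q * (3 * (x + y) - (x ^ 2 + x * y + y ^ 2)) := mul_nonneg hq (by linarith)
    nlinarith [sq_nonneg q]
  nlinarith [mul_pos (sub_pos.2 hxy) key]

lemma bisectionValue_cross_sub (p x y : ℝ) :
    (2 * p + 6 * x) * (3 * (p + y) ^ 2 - p ^ 3 - 3 * p * y ^ 2) -
      (2 * p + 6 * y) * (3 * (p + x) ^ 2 - p ^ 3 - 3 * p * x ^ 2) =
    6 * (y - x) * (1 - p) * (p * (x + y) - p ^ 2 + 3 * x * y) := by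
  ring

lemma bisectionValue_strictMonoOn_right {p : ℝ} (hp : 0 < p) (hp1 : p < 1) :
    StrictMonoOn (fun q => bisectionValue p q) (Set.Ico 0 (p / 3)) := by
  rintro x ⟨hx, hxp⟩ y ⟨hy, hyp⟩ hxy
  simp only [bisectionValue]
  rw [div_lt_div_iff₀ (bisectionValue_denom_pos hp hp1.le hx)
    (bisectionValue_denom_pos hp hp1.le hy), ← sub_neg, bisectionValue_cross_sub]
  have h : p * (x + y) - p ^ 2 + 3 * x * y < 0 := by nlinarith
  exact mul_neg_of_pos_of_neg
    (mul_pos (mul_pos (by norm_num) (sub_pos.2 hxy)) (sub_pos.2 hp1)) h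

lemma bisectionValue_strictAntiOn_right {p : ℝ} (hp : 0 < p) (hp1 : p < 1) :
    StrictAntiOn (fun q => bisectionValue p q) (Set.Ico (p / 3) p) := by
  rintro x ⟨hx, hxp⟩ y ⟨hy, hyp⟩ hxy
  simp only [bisectionValue]
  rw [div_lt_div_iff₀ (bisectionValue_denom_pos hp hp1.le (by linarith))
    (bisectionValue_denom_pos hp hp1.le (by linarith)), ← sub_pos, bisectionValue_cross_sub]
  have h : 0 < p * (x + y) - p ^ 2 + 3 * x * y := by nlinarith
  exact mul_pos (mul_pos (mul_pos (by norm_num) (sub_pos.2 hxy)) (sub_pos.2 hp1)) h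

lemma bisectionValue_one {q : ℝ} (hq : 0 ≤ q) : bisectionValue 1 q = 1 := by
  rw [bisectionValue, div_eq_one_iff_eq]
  · ring
  · have := bisectionValue_denom_pos one_pos le_rfl hq
    exact this.ne'

namespace HCTree

variable {V : Type}

lemma mergesFirst_iff_not_le (T : HCTree V) (i j k : V) :
    T.MergesFirst i j k ↔ ¬ T.leaf i ⊓ T.leaf j ≤ T.leaf k :=
  inf_lt_left

lemma mergesFirst_iff_exists (T : HCTree V) (i j k : V) :
    T.MergesFirst i j k ↔ ∃ c, c ≤ T.leaf i ∧ c ≤ T.leaf j ∧ ¬ c ≤ T.leaf k := by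
  rw [mergesFirst_iff_not_le]
  refine ⟨fun h => ⟨_, inf_le_left, inf_le_right, h⟩, ?_⟩
  rintro ⟨c, hi, hj, hk⟩ h
  exact hk ((le_inf hi hj).trans h)

lemma not_mergesFirst_left (T : HCTree V) (i j : V) : ¬ T.MergesFirst i j i := by
  simp [mergesFirst_iff_not_le]

lemma not_mergesFirst_right (T : HCTree V) (i j : V) : ¬ T.MergesFirst i j j := by
  simp [mergesFirst_iff_not_le]

lemma MergesFirst.symm {T : HCTree V} {i j k : V} (h : T.MergesFirst i j k) :
    T.MergesFirst j i k := by
  rwa [mergesFirst_iff_not_le, inf_comm, ← mergesFirst_iff_not_le]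

lemma MergesFirst.trans {T : HCTree V} {a b c k : V} (hab : T.MergesFirst a b k)
    (hbc : T.MergesFirst b c k) : T.MergesFirst a c k := by
  rw [mergesFirst_iff_exists] at *
  obtain ⟨x, hxa, hxb, hx⟩ := hab
  obtain ⟨y, hyb, hyc, hy⟩ := hbc
  rcases (le_total_of_directed hxb hyb).symm with h | h
  · exact ⟨x, hxa, h.trans hyc, hx⟩
  · exact ⟨y, h.trans hxa, hyc, hy⟩

lemma MergesFirst.not_right {T : HCTree V} {i j k : V} (h : T.MergesFirst i j k) :
    ¬ T.MergesFirst i k j := by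
  intro h'
  rw [mergesFirst_iff_exists] at *
  obtain ⟨x, hxi, hxj, hxk⟩ := h
  obtain ⟨y, hyi, hyk, hyj⟩ := h'
  rcases (le_total_of_directed hxi hyi).symm with h | h
  · exact hxk (h.trans hyk)
  · exact hyj (h.trans hxj)

lemma MergesFirst.not_left {T : HCTree V} {i j k : V} (h : T.MergesFirst i j k) :
    ¬ T.MergesFirst j k i :=
  fun h' => h.symm.not_right h'

open Classical in
lemma tripletCost_eq (T : HCTree V) (w : V → V → ℝ) (i j k : V) :
    T.tripletCost w i j k = w i j * (if T.MergesFirst i j k then 0 else 1) +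
      w i k * (if T.MergesFirst i k j then 0 else 1) +
      w j k * (if T.MergesFirst j k i then 0 else 1) := by
  unfold tripletCost
  by_cases h1 : T.MergesFirst i j k
  · simp [h1, h1.not_right, h1.not_left]
  by_cases h2 : T.MergesFirst i k j
  · have h3 : ¬ T.MergesFirst j k i := fun h3 => h2.not_left h3.symm
    simp [h1, h2, h3]
  by_cases h3 : T.MergesFirst j k i
  · simp [h1, h2, h3]
  · simp [h1, h2, h3]; ring

/-- For fixed `k`, the leaves merging before `k` form the classes of an equivalence relation. -/
def mergeSetoid (T : HCTree V) (k : V) : Setoid V where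
  r i j := i = j ∨ T.MergesFirst i j k
  iseqv :=
    { refl := fun _ => Or.inl rfl
      symm := fun h => h.imp Eq.symm MergesFirst.symm
      trans := by
        rintro a b c (rfl | hab) hbc
        · exact hbc
        · rcases hbc with rfl | hbc
          · exact Or.inr hab
          · exact Or.inr (hab.trans hbc) }

end HCTree

lemma Setoid.exists_map_eq_iff {V : Type*} (s : Setoid V) :
    ∃ f : V → V, ∀ i j, f i = f j ↔ s i j :=
  ⟨fun v => (Quotient.mk s v).out, fun i j => by
    rw [Quotient.out_inj]
    exact Quotient.eq⟩

/-- The sum of the entries of `x` over the pairs that are not separated by `f`. -/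
def pairSum {n : ℕ} (x : Fin n → Fin n → ℝ) (f : Fin n → Fin n) : ℝ :=
  ∑ e : VertexPair n, if f e.1.1 = f e.1.2 then x e.1.1 e.1.2 else 0

lemma sum_vertexPair {n : ℕ} (h : Fin n → Fin n → ℝ) :
    ∑ e : VertexPair n, h e.1.1 e.1.2 = ∑ i, ∑ j, if i < j then h i j else 0 := by
  rw [← Fintype.sum_prod_type' (fun i j => if i < j then h i j else 0), ← Finset.sum_filter]
  exact (Finset.sum_subtype _ (by simp) (fun e : Fin n × Fin n => h e.1 e.2)).symm

lemma sum_triplets {n : ℕ} (h : Fin n → Fin n → Fin n → ℝ) :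
    ∑ t ∈ triplets n, h t.1 t.2.1 t.2.2 =
      ∑ i, ∑ j, ∑ k, if i < j ∧ j < k then h i j k else 0 := by
  rw [triplets, Finset.sum_filter, Fintype.sum_prod_type]
  exact Finset.sum_congr rfl fun i _ => Fintype.sum_prod_type _

/-- Summing over triplets with a distinguished element amounts to summing over a pair and a third
element. -/
lemma sum_triplets_eq_sum_vertexPair {n : ℕ} (h : Fin n → Fin n → Fin n → ℝ)
    (hl : ∀ i j, h i j i = 0) (hr : ∀ i j, h i j j = 0) :
    ∑ t ∈ triplets n, (h t.1 t.2.1 t.2.2 + h t.1 t.2.2 t.2.1 + h t.2.1 t.2.2 t.1) =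
      ∑ k, ∑ e : VertexPair n, h e.1.1 e.1.2 k := by
  rw [Finset.sum_add_distrib, Finset.sum_add_distrib, sum_triplets h,
    sum_triplets (fun i j k => h i k j), sum_triplets (fun i j k => h j k i),
    Finset.sum_comm (s := (Finset.univ : Finset (Fin n)))
      (t := (Finset.univ : Finset (VertexPair n))),
    sum_vertexPair (fun i j => ∑ k, h i j k)]
  have h2 : (∑ i, ∑ j, ∑ k, if i < j ∧ j < k then h i k j else 0) =
      ∑ i : Fin n, ∑ j, ∑ k, if i < k ∧ k < j then h i j k else 0 :=
    Finset.sum_congr rfl fun i _ => Finset.sum_comm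
  have h3 : (∑ i, ∑ j, ∑ k, if i < j ∧ j < k then h j k i else 0) =
      ∑ i : Fin n, ∑ j, ∑ k, if k < i ∧ i < j then h i j k else 0 := by
    rw [Finset.sum_comm]
    exact Finset.sum_congr rfl fun i _ => Finset.sum_comm
  rw [h2, h3, ← Finset.sum_add_distrib, ← Finset.sum_add_distrib]
  refine Finset.sum_congr rfl fun i _ => ?_
  rw [← Finset.sum_add_distrib, ← Finset.sum_add_distrib]
  refine Finset.sum_congr rfl fun j _ => ?_
  rw [← Finset.sum_add_distrib, ← Finset.sum_add_distrib]
  split_ifs with hij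
  · refine Finset.sum_congr rfl fun k _ => ?_
    rcases lt_trichotomy k i with hk | rfl | hk
    · simp [hk, hk.not_gt, (hk.trans hij).not_gt, hij]
    · simp [hl]
    · rcases lt_trichotomy k j with hk' | rfl | hk'
      · simp [hk, hk', hk.not_gt, hk'.not_gt]
      · simp [hr]
      · simp [hk.not_gt, hk'.not_gt, hk', hij]
  · refine Finset.sum_eq_zero fun k _ => ?_
    have h' : ¬ (i < k ∧ k < j) := fun h => hij (h.1.trans h.2)
    simp [hij, h']

lemma totalCost_sub {n : ℕ} (w w' : Fin n → Fin n → ℝ) (T : HCTree (Fin n)) :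
    totalCost (w - w') T = totalCost w T - totalCost w' T := by
  simp only [totalCost, ← Finset.sum_sub_distrib]
  refine Finset.sum_congr rfl fun t _ => ?_
  simp only [HCTree.tripletCost_eq, Pi.sub_apply]
  ring

lemma exists_totalCost_eq_sum_pairSum {n : ℕ} (x : Fin n → Fin n → ℝ) (T : HCTree (Fin n)) :
    ∃ f g : Fin n → Fin n → Fin n,
      totalCost x T = ∑ k, (pairSum x (f k) - pairSum x (g k)) := by
  classical
  let r : Fin n → Setoid (Fin n) := fun k =>
    { r := fun i j => i = j ∨ (i ≠ k ∧ j ≠ k)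
      iseqv := ⟨fun _ => Or.inl rfl, by grind, by grind⟩ }
  choose f hf using fun k => (r k).exists_map_eq_iff
  choose g hg using fun k => (T.mergeSetoid k).exists_map_eq_iff
  refine ⟨f, g, ?_⟩
  have key := sum_triplets_eq_sum_vertexPair
    (fun i j k => x i j * (if i = k ∨ j = k ∨ T.MergesFirst i j k then 0 else 1))
    (by simp) (by simp)
  have h1 : totalCost x T = _ := Eq.trans ?_ key
  · rw [h1]
    refine Finset.sum_congr rfl fun k _ => ?_
    rw [pairSum, pairSum, ← Finset.sum_sub_distrib]
    refine Finset.sum_congr rfl fun e _ => ?_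
    have hne : e.1.1 ≠ e.1.2 := e.2.ne
    have h1 : f k e.1.1 = f k e.1.2 ↔ e.1.1 ≠ k ∧ e.1.2 ≠ k :=
      (hf k _ _).trans (or_iff_right hne)
    have h2 : g k e.1.1 = g k e.1.2 ↔ T.MergesFirst e.1.1 e.1.2 k :=
      (hg k _ _).trans (or_iff_right hne)
    simp only [h1, h2]
    by_cases hi : e.1.1 = k
    · have := T.not_mergesFirst_left e.1.1 e.1.2
      rw [hi] at this
      simp [hi, this]
    by_cases hj : e.1.2 = k
    · have := T.not_mergesFirst_right e.1.1 e.1.2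
      rw [hj] at this
      simp [hj, this]
    by_cases hm : T.MergesFirst e.1.1 e.1.2 k <;> simp [hi, hj, hm]
  · refine Finset.sum_congr rfl fun t ht => ?_
    simp only [triplets, Finset.mem_filter, Finset.mem_univ, true_and] at ht
    have h12 := ht.1.ne
    have h23 := ht.2.ne
    have h13 := (ht.1.trans ht.2).ne
    simp [HCTree.tripletCost_eq, h12, h23, h13, h12.symm, h23.symm, h13.symm]

lemma abs_totalCost_le {n : ℕ} {x : Fin n → Fin n → ℝ} {t : ℝ}
    (h : ∀ f : Fin n → Fin n, |pairSum x f| ≤ t) (T : HCTree (Fin n)) :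
    |totalCost x T| ≤ 2 * n * t := by
  obtain ⟨f, g, hfg⟩ := exists_totalCost_eq_sum_pairSum x T
  rw [hfg]
  calc |∑ k, (pairSum x (f k) - pairSum x (g k))|
      ≤ ∑ k, |pairSum x (f k) - pairSum x (g k)| := Finset.abs_sum_le_sum_abs _ _
    _ ≤ ∑ _k : Fin n, (t + t) :=
        Finset.sum_le_sum fun k _ => (abs_sub _ _).trans (add_le_add (h _) (h _))
    _ = 2 * n * t := by simp; ring

section FiniteTreeOrder

variable {α : Type*} [PartialOrder α] [Finite α]

lemma exists_isGreatest_of_chain {s : Set α} (hs : s.Nonempty)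
    (hchain : ∀ a ∈ s, ∀ b ∈ s, a ≤ b ∨ b ≤ a) : ∃ m, IsGreatest s m := by
  obtain ⟨m, hm⟩ := (Set.toFinite s).exists_maximal hs
  exact ⟨m, hm.prop, fun b hb => (hchain b hb m hm.prop).elim id (fun h => hm.le_of_ge hb h)⟩

lemma exists_rootedTree_order [OrderBot α] (h : ∀ a b c : α, a ≤ c → b ≤ c → a ≤ b ∨ b ≤ a) :
    (∃ inf : α → α → α, ∀ a b, IsGreatest {c | c ≤ a ∧ c ≤ b} (inf a b)) ∧
    ∃ pred : α → α, ∀ a, a ≠ ⊥ → IsGreatest {c | c < a} (pred a) := by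
  classical
  constructor
  · choose f hf using fun a b : α => exists_isGreatest_of_chain (s := {c | c ≤ a ∧ c ≤ b})
      ⟨⊥, bot_le, bot_le⟩ (fun x hx y hy => h x y a hx.1 hy.1)
    exact ⟨f, hf⟩
  · have (a : α) : ∃ m, a ≠ ⊥ → IsGreatest {c | c < a} m := by
      by_cases ha : a = ⊥
      · exact ⟨⊥, fun h => (h ha).elim⟩
      · obtain ⟨m, hm⟩ := exists_isGreatest_of_chain (s := {c | c < a})
          ⟨⊥, bot_lt_iff_ne_bot.2 ha⟩ (fun x hx y hy => h x y a hx.le hy.le)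
        exact ⟨m, fun _ => hm⟩
    choose f hf using this
    exact ⟨f, hf⟩

end FiniteTreeOrder

/-- A finite order with a least element in which the elements below any element form a chain
is the ancestorship order of a rooted tree. -/
lemma exists_rootedTree_orderIso {α : Type} [PartialOrder α] [OrderBot α] [Finite α]
    (h : ∀ a b c : α, a ≤ c → b ≤ c → a ≤ b ∨ b ≤ a) :
    ∃ T : RootedTree.{0}, Nonempty (T ≃o α) := by
  classical
  obtain ⟨⟨inf, hinf⟩, ⟨pred, hpred⟩⟩ := exists_rootedTree_order h
  let _ : SemilatticeInf α :=
    { inf := inf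
      inf_le_left := fun a b => (hinf a b).1.1
      inf_le_right := fun a b => (hinf a b).1.2
      le_inf := fun a b c hab hac => (hinf b c).2 ⟨hab, hac⟩ }
  let _ : PredOrder α :=
    { pred := fun a => if a = ⊥ then ⊥ else pred a
      pred_le := fun a => by
        split_ifs with ha
        · exact bot_le
        · exact (hpred a ha).1.le
      min_of_le_pred := fun {a} hle => by
        split_ifs at hle with ha
        · exact ha ▸ isMin_bot
        · exact absurd (hpred a ha).1 hle.not_gt
      le_pred_of_lt := fun {a b} hlt => by
        have hb : b ≠ ⊥ := (bot_le.trans_lt hlt).ne'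
        simp only [hb, if_false]
        exact (hpred b hb).2 hlt }
  exact ⟨⟨α⟩, ⟨OrderIso.refl α⟩⟩

/-- A laminar family of nonempty sets containing the whole set and the singletons is a hierarchical
clustering tree. -/
lemma exists_hcTree_of_laminar {V : Type} [Fintype V] [DecidableEq V] (𝓛 : Set (Finset V))
    (hne : ∀ S ∈ 𝓛, S.Nonempty) (huniv : Finset.univ ∈ 𝓛) (hsing : ∀ v, {v} ∈ 𝓛)
    (hlam : ∀ S ∈ 𝓛, ∀ S' ∈ 𝓛, ∀ v, v ∈ S → v ∈ S' → S ⊆ S' ∨ S' ⊆ S) :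
    ∃ T : HCTree V, ∀ i j k, T.MergesFirst i j k ↔ ∃ S ∈ 𝓛, i ∈ S ∧ j ∈ S ∧ k ∉ S := by
  let α : Type := {S : (Finset V)ᵒᵈ // OrderDual.ofDual S ∈ 𝓛}
  have hle (a b : α) : a ≤ b ↔ OrderDual.ofDual b.1 ⊆ OrderDual.ofDual a.1 := Iff.rfl
  let _ : OrderBot α :=
    { bot := ⟨OrderDual.toDual Finset.univ, huniv⟩
      bot_le := fun a => (hle _ _).2 (Finset.subset_univ _) }
  have hchain (a b c : α) (hac : a ≤ c) (hbc : b ≤ c) : a ≤ b ∨ b ≤ a := by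
    obtain ⟨v, hv⟩ := hne _ c.2
    exact (hlam _ a.2 _ b.2 v (hac hv) (hbc hv)).symm
  obtain ⟨T, ⟨φ⟩⟩ := exists_rootedTree_orderIso hchain
  let single : V → α := fun v => ⟨OrderDual.toDual {v}, hsing v⟩
  have hsingle (a : α) (v : V) : a ≤ single v ↔ v ∈ OrderDual.ofDual a.1 :=
    (hle _ _).trans Finset.singleton_subset_iff
  have hmax (a : α) : IsMax a ↔ ∃ v, single v = a := by
    constructor
    · intro ha
      obtain ⟨v, hv⟩ := hne _ a.2
      have h1 := (hsingle a v).2 hv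
      exact ⟨v, le_antisymm (ha h1) h1⟩
    · rintro ⟨v, rfl⟩ b hb
      obtain ⟨u, hu⟩ := hne _ b.2
      have h1 : u ∈ ({v} : Finset V) := hb hu
      rw [Finset.mem_singleton] at h1
      exact (hsingle b v).2 (h1 ▸ hu)
  let T' : HCTree V :=
    { tree := T
      finite_nodes := Finite.of_equiv α φ.symm.toEquiv
      leaf := fun v => φ.symm (single v)
      leaf_injective := by
        refine φ.symm.injective.comp fun u v huv => ?_
        have h1 := (hsingle (single u) v).1 huv.le
        exact (Finset.mem_singleton.1 h1).symm
      range_leaf := by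
        ext x
        rw [Set.mem_ofPred_eq, ← φ.isMax_apply, hmax]
        exact exists_congr fun v => φ.symm_apply_eq }
  refine ⟨T', fun i j k => ?_⟩
  have hleaf (c : α) (v : V) : φ.symm c ≤ T'.leaf v ↔ v ∈ OrderDual.ofDual c.1 :=
    φ.symm.le_iff_le.trans (hsingle c v)
  rw [HCTree.mergesFirst_iff_exists]
  constructor
  · rintro ⟨c, hi, hj, hk⟩
    obtain ⟨c, rfl⟩ := φ.symm.surjective c
    exact ⟨_, c.2, (hleaf c i).1 hi, (hleaf c j).1 hj, fun h => hk ((hleaf c k).2 h)⟩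
  · rintro ⟨S, hS, hi, hj, hk⟩
    let c : α := ⟨OrderDual.toDual S, hS⟩
    exact ⟨φ.symm c, (hleaf c i).2 hi, (hleaf c j).2 hj, fun h => hk ((hleaf c k).1 h)⟩

/-- The vertex belongs to the first of the two planted clusters. -/
abbrev InFirstHalf {n : ℕ} (i : Fin n) : Prop := 2 * (i.val + 1) ≤ n

lemma InFirstHalf.of_le {n : ℕ} {i j : Fin n} (h : InFirstHalf j) (hij : i ≤ j) :
    InFirstHalf i := by
  have : i.val ≤ j.val := hij
  simp only [InFirstHalf] at *
  omega

/-- The triplet lies in one of the two planted clusters. -/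
abbrev SameHalf {n : ℕ} (t : Fin n × Fin n × Fin n) : Prop :=
  (InFirstHalf t.1 ↔ InFirstHalf t.2.1) ∧ (InFirstHalf t.2.1 ↔ InFirstHalf t.2.2)

/-- The edge probabilities of the planted bisection model, as real numbers. -/
def plantedWeight (n : ℕ) (p q : ℝ) (i j : Fin n) : ℝ :=
  if (InFirstHalf i ↔ InFirstHalf j) then p else q

lemma coe_plantedBisection (n : ℕ) (p q : I) (i j : Fin n) :
    (plantedBisection n p q i j : ℝ) = plantedWeight n p q i j := by
  unfold plantedBisection plantedWeight
  split_ifs <;> rfl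

/-- The least cost of a tree for the edge probabilities of the planted bisection model. -/
def plantedCost (n : ℕ) (p q : ℝ) : ℝ :=
  ∑ t ∈ triplets n, if SameHalf t then 2 * p else 2 * q

lemma plantedCost_le_totalCost {n : ℕ} {p q : ℝ} (hq : 0 ≤ q) (hqp : q ≤ p)
    (T : HCTree (Fin n)) : plantedCost n p q ≤ totalCost (plantedWeight n p q) T := by
  refine Finset.sum_le_sum fun t _ => ?_
  unfold HCTree.tripletCost plantedWeight SameHalf
  by_cases h1 : InFirstHalf t.1 <;> by_cases h2 : InFirstHalf t.2.1 <;>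
    by_cases h3 : InFirstHalf t.2.2 <;> simp only [h1, h2, h3] <;> simp <;> split_ifs <;> linarith

lemma exists_hcTree_planted {n : ℕ} (hn : 0 < n) :
    ∃ T : HCTree (Fin n), ∀ p q : ℝ, totalCost (plantedWeight n p q) T = plantedCost n p q := by
  classical
  let tail : Fin n → Finset (Fin n) := fun v =>
    Finset.univ.filter fun u => (InFirstHalf u ↔ InFirstHalf v) ∧ v ≤ u
  have mem_tail (u v : Fin n) : u ∈ tail v ↔ (InFirstHalf u ↔ InFirstHalf v) ∧ v ≤ u := by
    simp [tail]
  let 𝓛 : Set (Finset (Fin n)) :=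
    {S | S = Finset.univ ∨ (∃ v, S = {v}) ∨ ∃ v, S = tail v}
  have hself (v : Fin n) : v ∈ tail v := (mem_tail v v).2 ⟨Iff.rfl, le_rfl⟩
  have hmono (u v w : Fin n) (hu : w ∈ tail u) (hv : w ∈ tail v) (huv : u ≤ v) :
      tail v ⊆ tail u := by
    intro x hx
    rw [mem_tail] at *
    exact ⟨hx.1.trans (hv.1.symm.trans hu.1), huv.trans hx.2⟩
  obtain ⟨T, hT⟩ := exists_hcTree_of_laminar 𝓛
    (by
      rintro S (rfl | ⟨v, rfl⟩ | ⟨v, rfl⟩)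
      · exact ⟨⟨0, hn⟩, Finset.mem_univ _⟩
      · exact Finset.singleton_nonempty v
      · exact ⟨v, hself v⟩)
    (Or.inl rfl) (fun v => Or.inr (Or.inl ⟨v, rfl⟩))
    (by
      rintro S hS S' hS' w hw hw'
      rcases hS with rfl | ⟨v, rfl⟩ | ⟨v, rfl⟩
      · exact Or.inr (Finset.subset_univ _)
      · rw [Finset.mem_singleton] at hw
        exact Or.inl (Finset.singleton_subset_iff.2 (hw ▸ hw'))
      · rcases hS' with rfl | ⟨v', rfl⟩ | ⟨v', rfl⟩
        · exact Or.inl (Finset.subset_univ _)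
        · rw [Finset.mem_singleton] at hw'
          exact Or.inr (Finset.singleton_subset_iff.2 (hw' ▸ hw))
        · rcases le_total v v' with h | h
          · exact Or.inr (hmono _ _ w hw hw' h)
          · exact Or.inl (hmono _ _ w hw' hw h))
  have hmerge (i j k : Fin n) (v : Fin n) (hi : i ∈ tail v) (hj : j ∈ tail v) (hk : k ∉ tail v) :
      T.MergesFirst i j k :=
    (hT i j k).2 ⟨tail v, Or.inr (Or.inr ⟨v, rfl⟩), hi, hj, hk⟩
  refine ⟨T, fun p q => Finset.sum_congr rfl fun t ht => ?_⟩
  obtain ⟨i, j, k⟩ := t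
  simp only [triplets, Finset.mem_filter, Finset.mem_univ, true_and] at ht
  obtain ⟨hij, hjk⟩ := ht
  simp only [SameHalf]
  by_cases hcase : InFirstHalf j ∧ ¬ InFirstHalf k
  · have hi : InFirstHalf i := hcase.1.of_le hij.le
    have hm : T.MergesFirst i j k := hmerge i j k i (hself i)
      ((mem_tail _ _).2 ⟨by simp only [hi, hcase.1], hij.le⟩) (by simp only [mem_tail]; tauto)
    simp only [HCTree.tripletCost, hm, plantedWeight, hi, hcase.1, hcase.2]
    simp; ring
  · have hjk' : InFirstHalf j ↔ InFirstHalf k := ⟨fun h => by tauto, fun h => h.of_le hjk.le⟩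
    have hm : T.MergesFirst j k i := hmerge j k i j (hself j)
      ((mem_tail _ _).2 ⟨hjk'.symm, hjk.le⟩) (by rw [mem_tail]; exact fun h => h.2.not_gt hij)
    have hm1 : ¬ T.MergesFirst i j k := fun h => h.not_left hm
    have hm2 : ¬ T.MergesFirst i k j := fun h => h.not_left hm.symm
    simp only [HCTree.tripletCost, hm, hm1, hm2, plantedWeight]
    by_cases h1 : InFirstHalf i <;> by_cases h2 : InFirstHalf j <;> by_cases h3 : InFirstHalf k <;>
      simp [h1, h2, h3] at hjk' ⊢ <;> ring

lemma card_triplets_filter {n : ℕ} (A : Finset (Fin n)) :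
    ((triplets n).filter fun t => t.1 ∈ A ∧ t.2.1 ∈ A ∧ t.2.2 ∈ A).card = A.card.choose 3 := by
  rw [← Finset.card_powersetCard]
  refine Finset.card_bij (fun t _ => {t.1, t.2.1, t.2.2}) ?_ ?_ ?_
  · rintro ⟨i, j, k⟩ ht
    simp only [triplets, Finset.mem_filter, Finset.mem_univ, true_and] at ht
    obtain ⟨⟨hij, hjk⟩, hi, hj, hk⟩ := ht
    rw [Finset.mem_powersetCard]
    refine ⟨by simp [Finset.insert_subset_iff, hi, hj, hk], ?_⟩
    exact Finset.card_eq_three.2 ⟨i, j, k, hij.ne, (hij.trans hjk).ne, hjk.ne, rfl⟩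
  · rintro ⟨i, j, k⟩ ht ⟨i', j', k'⟩ ht' h
    simp only [triplets, Finset.mem_filter, Finset.mem_univ, true_and] at ht ht'
    obtain ⟨⟨hij, hjk⟩, -⟩ := ht
    obtain ⟨⟨hij', hjk'⟩, -⟩ := ht'
    simp only at h
    have m1 : i ∈ ({i', j', k'} : Finset (Fin n)) := by simp [← h]
    have m2 : j ∈ ({i', j', k'} : Finset (Fin n)) := by simp [← h]
    have m3 : k ∈ ({i', j', k'} : Finset (Fin n)) := by simp [← h]
    simp only [Finset.mem_insert, Finset.mem_singleton] at m1 m2 m3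
    have : i = i' ∧ j = j' ∧ k = k' := by omega
    simp [this]
  · intro S hS
    rw [Finset.mem_powersetCard] at hS
    obtain ⟨hSA, hcard⟩ := hS
    let f := S.orderEmbOfFin hcard
    have hf : ∀ a, f a ∈ S := S.orderEmbOfFin_mem hcard
    have h01 : f 0 < f 1 := f.strictMono (by decide)
    have h12 : f 1 < f 2 := f.strictMono (by decide)
    refine ⟨(f 0, f 1, f 2), ?_, ?_⟩
    · simp only [triplets, Finset.mem_filter, Finset.mem_univ, true_and]
      exact ⟨⟨h01, h12⟩, hSA (hf _), hSA (hf _), hSA (hf _)⟩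
    · refine Finset.eq_of_subset_of_card_le (by simp [Finset.insert_subset_iff, hf]) ?_
      rw [hcard, Finset.card_eq_three.2 ⟨_, _, _, h01.ne, (h01.trans h12).ne, h12.ne, rfl⟩]

lemma cast_choose_three (m : ℕ) : (m.choose 3 : ℝ) = m * (m - 1) * (m - 2) / 6 := by
  induction m with
  | zero => simp
  | succ m ih =>
    rw [Nat.choose_succ_succ]
    push_cast
    rw [ih, Nat.cast_choose_two]
    ring

lemma card_triplets (n : ℕ) : (triplets n).card = n.choose 3 := by
  simpa using card_triplets_filter (Finset.univ : Finset (Fin n))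

lemma card_inFirstHalf (n : ℕ) :
    (Finset.univ.filter fun i : Fin n => InFirstHalf i).card = n / 2 := by
  have h : (Finset.univ.filter fun i : Fin n => InFirstHalf i) =
      Finset.univ.filter fun i : Fin n => i.val < n / 2 := by
    ext i
    simp only [Finset.mem_filter, Finset.mem_univ, true_and, InFirstHalf]
    omega
  rw [h, Fin.card_filter_val_lt]
  omega

lemma card_sameHalf (n : ℕ) :
    ((triplets n).filter fun t => SameHalf t).card = (n / 2).choose 3 + (n - n / 2).choose 3 := by
  have h1 := card_triplets_filter (Finset.univ.filter fun i : Fin n => InFirstHalf i)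
  have h2 := card_triplets_filter (Finset.univ.filter fun i : Fin n => ¬ InFirstHalf i)
  have h3 := Finset.card_filter_add_card_filter_not (s := (Finset.univ : Finset (Fin n)))
    (fun i => InFirstHalf i)
  rw [card_inFirstHalf, Finset.card_fin] at h3
  rw [card_inFirstHalf] at h1
  rw [← h1, show n - n / 2 = _ from (Nat.eq_sub_of_add_eq' h3).symm, ← h2,
    ← Finset.card_union_of_disjoint]
  · congr 1
    ext t
    simp only [Finset.mem_union, Finset.mem_filter, Finset.mem_univ, true_and, SameHalf]
    tauto
  · rw [Finset.disjoint_filter]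
    intro t _ h h'
    simp only [Finset.mem_filter, Finset.mem_univ, true_and] at h h'
    exact h'.1 h.1

lemma abs_card_sameHalf_sub_le (n : ℕ) :
    |(((triplets n).filter fun t => SameHalf t).card : ℝ) - (n : ℝ) ^ 3 / 24| ≤ (n : ℝ) ^ 2 := by
  rw [card_sameHalf]
  push_cast
  rw [cast_choose_three, cast_choose_three]
  obtain ⟨m, rfl | rfl⟩ := Nat.even_or_odd' n
  · have h1 : 2 * m / 2 = m := by omega
    have h2 : 2 * m - m = m := by omega
    rw [h1, h2]
    push_cast
    have : (0 : ℝ) ≤ m := m.cast_nonneg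
    rw [abs_le]
    rcases Nat.eq_zero_or_pos m with rfl | hm
    · simp
    have : (1 : ℝ) ≤ m := by exact_mod_cast hm
    constructor <;> nlinarith
  · have h1 : (2 * m + 1) / 2 = m := by omega
    have h2 : 2 * m + 1 - m = m + 1 := by omega
    rw [h1, h2]
    push_cast
    have : (0 : ℝ) ≤ m := m.cast_nonneg
    rw [abs_le]
    constructor <;> nlinarith

lemma abs_card_not_sameHalf_sub_le (n : ℕ) :
    |(((triplets n).filter fun t => ¬ SameHalf t).card : ℝ) - (n : ℝ) ^ 3 / 8| ≤
      2 * (n : ℝ) ^ 2 := by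
  have h := Finset.card_filter_add_card_filter_not (s := triplets n) (fun t => SameHalf t)
  rw [card_triplets] at h
  have h' : (((triplets n).filter fun t => ¬ SameHalf t).card : ℝ) =
      n.choose 3 - ((triplets n).filter fun t => SameHalf t).card := by
    rw [← h]; push_cast; ring
  have h1 := abs_card_sameHalf_sub_le n
  rw [h', cast_choose_three]
  rw [abs_le] at *
  have h0 : (n : ℝ) ≤ n ^ 2 := by
    rw [sq]; exact_mod_cast Nat.le_mul_self n
  constructor <;> nlinarith [sq_nonneg (n : ℝ)]

/-- A sum over triplets depending only on whether they are split by the planted clusters. -/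
lemma abs_sum_triplets_sameHalf_sub_le {n : ℕ} (hn : 0 < n) {a b : ℝ} (ha : 0 ≤ a) (hb : 0 ≤ b) :
    |(∑ t ∈ triplets n, if SameHalf t then a else b) - n ^ 3 / 24 * (a + 3 * b)| ≤
      24 / n * (n ^ 3 / 24 * (a + 3 * b)) := by
  rw [Finset.sum_ite, Finset.sum_const, Finset.sum_const, nsmul_eq_mul, nsmul_eq_mul]
  have h1 := mul_le_mul_of_nonneg_right (abs_card_sameHalf_sub_le n) ha
  have h2 := mul_le_mul_of_nonneg_right (abs_card_not_sameHalf_sub_le n) hb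
  set s : ℝ := (((triplets n).filter fun t => SameHalf t).card : ℝ)
  set m : ℝ := (((triplets n).filter fun t => ¬ SameHalf t).card : ℝ)
  have hn' : (0 : ℝ) < n := by exact_mod_cast hn
  calc |s * a + m * b - n ^ 3 / 24 * (a + 3 * b)|
      = |(s - n ^ 3 / 24) * a + (m - n ^ 3 / 8) * b| := by congr 1; ring
    _ ≤ |s - n ^ 3 / 24| * a + |m - n ^ 3 / 8| * b := by
        refine (abs_add_le _ _).trans_eq ?_
        rw [abs_mul, abs_mul, abs_of_nonneg ha, abs_of_nonneg hb]
    _ ≤ n ^ 2 * a + 2 * n ^ 2 * b := add_le_add h1 h2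
    _ ≤ n ^ 2 * (a + 3 * b) := by nlinarith [mul_nonneg (sq_nonneg (n : ℝ)) hb]
    _ = 24 / n * (n ^ 3 / 24 * (a + 3 * b)) := by field_simp

/-- The law of the edge indicators of the random graph with edge probabilities `P`. -/
noncomputable def pairMeasure {n : ℕ} (P : Fin n → Fin n → I) : Measure (VertexPair n → Prop) :=
  Measure.pi fun e : VertexPair n => bernoulliMeasure True False (P e.1.1 e.1.2)

instance {n : ℕ} (P : Fin n → Fin n → I) : IsProbabilityMeasure (pairMeasure P) :=
  inferInstanceAs (IsProbabilityMeasure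
    (Measure.pi fun e : VertexPair n => bernoulliMeasure True False (P e.1.1 e.1.2)))

open Classical in
/-- The numerical value of a proposition. -/
noncomputable def propInd (b : Prop) : ℝ := if b then 1 else 0

lemma propInd_eq_zero_or_one (b : Prop) : propInd b = 0 ∨ propInd b = 1 := by
  unfold propInd; split_ifs <;> simp

lemma propInd_nonneg (b : Prop) : 0 ≤ propInd b := by
  rcases propInd_eq_zero_or_one b with h | h <;> simp [h]

lemma propInd_le_one (b : Prop) : propInd b ≤ 1 := by
  rcases propInd_eq_zero_or_one b with h | h <;> simp [h]

lemma unitWeight_graphOfPairs {n : ℕ} (ω : VertexPair n → Prop) {i j : Fin n} (h : i < j) :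
    unitWeight (graphOfPairs ω) i j = propInd (ω ⟨(i, j), h⟩) := by
  have : (graphOfPairs ω).Adj i j ↔ ω ⟨(i, j), h⟩ := by simp [graphOfPairs, h, h.not_gt]
  unfold unitWeight propInd
  split_ifs <;> tauto

section PairMeasure

variable {n : ℕ} (P : Fin n → Fin n → I)

lemma integral_propInd (e : VertexPair n) :
    ∫ ω, propInd (ω e) ∂pairMeasure P = P e.1.1 e.1.2 := by
  rw [pairMeasure, integral_comp_eval (μ := fun e : VertexPair n =>
    bernoulliMeasure True False (P e.1.1 e.1.2)) (f := propInd) .of_discrete,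
    integral_bernoulliMeasure]
  simp [propInd]

lemma iIndepFun_comp_eval (g : VertexPair n → Prop → ℝ) :
    iIndepFun (fun e ω => g e (ω e)) (pairMeasure P) :=
  iIndepFun_pi fun _ => .of_discrete

lemma card_vertexPair_le (n : ℕ) : Fintype.card (VertexPair n) ≤ n ^ 2 := by
  refine (Fintype.card_subtype_le _).trans ?_
  simp [sq]

/-- Hoeffding's inequality for weighted sums of edge indicators. -/
lemma measureReal_le_weighted_sum_le (hn : 2 ≤ n) (r : VertexPair n → ℝ) (hr : ∀ e, |r e| ≤ 1)
    {t : ℝ} (ht : 0 ≤ t) :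
    (pairMeasure P).real {ω | t ≤ ∑ e, r e * (propInd (ω e) - P e.1.1 e.1.2)} ≤
      Real.exp (-t ^ 2 / (2 * n ^ 2)) := by
  have hindep := iIndepFun_comp_eval P fun e b => r e * (propInd b - P e.1.1 e.1.2)
  have hsub (e : VertexPair n) : HasSubgaussianMGF
      (fun ω : VertexPair n → Prop => r e * (propInd (ω e) - P e.1.1 e.1.2)) 1
        (pairMeasure P) := by
    have h := hasSubgaussianMGF_of_mem_Icc_of_integral_eq_zero (μ := pairMeasure P)
      (X := fun ω : VertexPair n → Prop => r e * (propInd (ω e) - P e.1.1 e.1.2))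
      (a := -1) (b := 1) .of_discrete (.of_forall fun ω => ?_) ?_
    · convert h using 1
      ext
      norm_num
    · have h1 : |propInd (ω e) - P e.1.1 e.1.2| ≤ 1 := by
        rw [abs_le]
        constructor <;> linarith [propInd_nonneg (ω e), propInd_le_one (ω e),
          (P e.1.1 e.1.2).2.1, (P e.1.1 e.1.2).2.2]
      have h2 : |r e * (propInd (ω e) - P e.1.1 e.1.2)| ≤ 1 := by
        rw [abs_mul]
        exact mul_le_one₀ (hr e) (abs_nonneg _) h1
      exact abs_le.1 h2
    · rw [integral_const_mul, integral_sub .of_finite .of_finite, integral_propInd]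
      simp
  refine (HasSubgaussianMGF.measure_sum_ge_le_of_iIndepFun hindep (s := Finset.univ)
    (fun e _ => hsub e) ht).trans ?_
  rw [Real.exp_le_exp, neg_div, neg_div, neg_le_neg_iff]
  have hpos : 0 < Fintype.card (VertexPair n) :=
    Fintype.card_pos_iff.2 ⟨⟨(⟨0, by omega⟩, ⟨1, by omega⟩), by simp⟩⟩
  have hpos' : (0 : ℝ) < Fintype.card (VertexPair n) := by exact_mod_cast hpos
  have hle : (Fintype.card (VertexPair n) : ℝ) ≤ (n : ℝ) ^ 2 := by
    exact_mod_cast card_vertexPair_le n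
  simp only [Finset.sum_const, Finset.card_univ, nsmul_eq_mul, mul_one, NNReal.coe_natCast]
  gcongr

lemma pairSum_unitWeight_sub (ω : VertexPair n → Prop) (f : Fin n → Fin n) :
    pairSum (unitWeight (graphOfPairs ω) - fun i j => (P i j : ℝ)) f =
      ∑ e : VertexPair n, (if f e.1.1 = f e.1.2 then 1 else 0) *
        (propInd (ω e) - P e.1.1 e.1.2) := by
  refine Finset.sum_congr rfl fun e _ => ?_
  rw [ite_mul, one_mul, zero_mul, Pi.sub_apply, Pi.sub_apply, unitWeight_graphOfPairs ω e.2]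

lemma measureReal_lt_abs_pairSum_le (hn : 2 ≤ n) (f : Fin n → Fin n) {t : ℝ} (ht : 0 ≤ t) :
    (pairMeasure P).real
      {ω | t < |pairSum (unitWeight (graphOfPairs ω) - fun i j => (P i j : ℝ)) f|} ≤
      2 * Real.exp (-t ^ 2 / (2 * n ^ 2)) := by
  let r : VertexPair n → ℝ := fun e => if f e.1.1 = f e.1.2 then 1 else 0
  have hr (e) : |r e| ≤ 1 := by
    simp only [r]; split_ifs <;> simp
  have h1 := measureReal_le_weighted_sum_le P hn r hr ht
  have h2 := measureReal_le_weighted_sum_le P hn (fun e => - r e) (by simpa using hr) ht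
  rw [two_mul]
  refine le_trans ?_ (add_le_add h1 h2)
  refine le_trans (measureReal_mono ?_) (measureReal_union_le _ _)
  intro ω hω
  rw [Set.mem_ofPred_eq, pairSum_unitWeight_sub, lt_abs] at hω
  refine hω.imp (fun h => h.le) fun h => ?_
  simp only [Set.mem_ofPred_eq, neg_mul, Finset.sum_neg_distrib]
  exact h.le

/-- All total costs are uniformly close to those for the edge probabilities. -/
lemma measureReal_exists_lt_abs_totalCost_le (hn : 2 ≤ n) {t : ℝ} (ht : 0 ≤ t) :
    (pairMeasure P).real {ω | ∃ T : HCTree (Fin n), 2 * n * t <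
      |totalCost (unitWeight (graphOfPairs ω)) T - totalCost (fun i j => (P i j : ℝ)) T|} ≤
      n ^ n * (2 * Real.exp (-t ^ 2 / (2 * n ^ 2))) := by
  calc _ ≤ (pairMeasure P).real (⋃ f : Fin n → Fin n,
        {ω | t < |pairSum (unitWeight (graphOfPairs ω) - fun i j => (P i j : ℝ)) f|}) := by
        refine measureReal_mono fun ω => ?_
        rintro ⟨T, hT⟩
        rw [← totalCost_sub] at hT
        by_contra hω
        simp only [Set.mem_iUnion, Set.mem_ofPred_eq, not_exists, not_lt] at hω
        exact hT.not_ge (abs_totalCost_le hω T)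
    _ ≤ ∑ f : Fin n → Fin n, (pairMeasure P).real
        {ω | t < |pairSum (unitWeight (graphOfPairs ω) - fun i j => (P i j : ℝ)) f|} :=
        measureReal_iUnion_fintype_le _
    _ ≤ ∑ _f : Fin n → Fin n, 2 * Real.exp (-t ^ 2 / (2 * n ^ 2)) :=
        Finset.sum_le_sum fun f _ => measureReal_lt_abs_pairSum_le P hn f ht
    _ = n ^ n * (2 * Real.exp (-t ^ 2 / (2 * n ^ 2))) := by simp

end PairMeasure

/-- Variance of a sum of bounded nonnegative variables with a sparse dependency graph. -/
lemma variance_sum_le_of_indep {Ω ι : Type*} [MeasurableSpace Ω] {μ : Measure Ω}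
    [IsProbabilityMeasure μ] (s : Finset ι) (X : ι → Ω → ℝ) (R : ι → ι → Prop)
    [∀ i, DecidablePred (R i)] {K : ℕ} {b : ℝ} (hX : ∀ i, MemLp (X i) 2 μ)
    (h0 : ∀ i ω, 0 ≤ X i ω) (hb : ∀ i ω, X i ω ≤ b)
    (hindep : ∀ i ∈ s, ∀ j ∈ s, ¬ R i j → IndepFun (X i) (X j) μ)
    (hcard : ∀ i ∈ s, (s.filter (R i)).card ≤ K) :
    Var[fun ω => ∑ i ∈ s, X i ω; μ] ≤ K * b * ∑ i ∈ s, ∫ ω, X i ω ∂μ := by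
  have hint (i : ι) : Integrable (X i) μ := (hX i).integrable (by norm_num)
  have hmean (i : ι) : 0 ≤ ∫ ω, X i ω ∂μ := integral_nonneg (h0 i)
  have hcov (i j : ι) : cov[X i, X j; μ] ≤ b * ∫ ω, X i ω ∂μ := by
    rw [covariance_eq_sub (hX i) (hX j), ← integral_const_mul b (X i)]
    refine (sub_le_self _ (mul_nonneg (hmean i) (hmean j))).trans ?_
    refine integral_mono ((hX i).integrable_mul (hX j)) ((hint i).const_mul b) fun ω => ?_
    rw [Pi.mul_apply, mul_comm]
    exact mul_le_mul_of_nonneg_right (hb j ω) (h0 i ω)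
  rw [variance_fun_sum' fun i _ => hX i, Finset.mul_sum]
  refine Finset.sum_le_sum fun i hi => ?_
  have hbi : 0 ≤ b * ∫ ω, X i ω ∂μ := by
    rw [← integral_const_mul]
    exact integral_nonneg fun ω => mul_nonneg ((h0 i ω).trans (hb i ω)) (h0 i ω)
  calc ∑ j ∈ s, cov[X i, X j; μ]
      ≤ ∑ j ∈ s, if R i j then b * ∫ ω, X i ω ∂μ else 0 := by
        refine Finset.sum_le_sum fun j hj => ?_
        split_ifs with hR
        · exact hcov i j
        · exact ((hindep i hi j hj hR).covariance_eq_zero (hX i) (hX j)).le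
    _ = (s.filter (R i)).card * (b * ∫ ω, X i ω ∂μ) := by
        rw [← Finset.sum_filter, Finset.sum_const, nsmul_eq_mul]
    _ ≤ K * (b * ∫ ω, X i ω ∂μ) := by
        have : ((s.filter (R i)).card : ℝ) ≤ K := by exact_mod_cast hcard i hi
        gcongr
    _ = K * b * ∫ ω, X i ω ∂μ := by ring

/-- The pairs of vertices of a triplet. -/
def tripletPairs {n : ℕ} (t : Fin n × Fin n × Fin n) : Finset (Fin n × Fin n) :=
  {(t.1, t.2.1), (t.1, t.2.2), (t.2.1, t.2.2)}

lemma card_filter_not_disjoint_le {n : ℕ} (s : Finset (Fin n × Fin n × Fin n))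
    (t : Fin n × Fin n × Fin n) :
    (s.filter fun t' => ¬ Disjoint (tripletPairs t) (tripletPairs t')).card ≤ 9 * n := by
  let N : Fin n × Fin n → Finset (Fin n × Fin n × Fin n) := fun e =>
    Finset.univ.image (fun m => (e.1, e.2, m)) ∪ Finset.univ.image (fun m => (e.1, m, e.2)) ∪
      Finset.univ.image (fun m => (m, e.1, e.2))
  have hN (e) : (N e).card ≤ 3 * n := by
    have h (g : Fin n → Fin n × Fin n × Fin n) : (Finset.univ.image g).card ≤ n := by
      simpa using Finset.card_image_le (s := Finset.univ) (f := g)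
    have h1 := h fun m => (e.1, e.2, m)
    have h2 := h fun m => (e.1, m, e.2)
    have h3 := h fun m => (m, e.1, e.2)
    refine (Finset.card_union_le _ _).trans ((add_le_add (Finset.card_union_le _ _) le_rfl).trans ?_)
    omega
  calc _ ≤ ((tripletPairs t).biUnion N).card := by
        refine Finset.card_le_card fun t' ht' => ?_
        rw [Finset.mem_filter, Finset.not_disjoint_iff] at ht'
        obtain ⟨-, e, he, he'⟩ := ht'
        rw [Finset.mem_biUnion]
        refine ⟨e, he, ?_⟩
        simp only [tripletPairs, Finset.mem_insert, Finset.mem_singleton] at he'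
        simp only [N, Finset.mem_union, Finset.mem_image, Finset.mem_univ, true_and]
        rcases he' with rfl | rfl | rfl
        · exact Or.inl (Or.inl ⟨_, rfl⟩)
        · exact Or.inl (Or.inr ⟨_, rfl⟩)
        · exact Or.inr ⟨_, rfl⟩
    _ ≤ (tripletPairs t).card * (3 * n) := Finset.card_biUnion_le_card_mul _ _ _ fun e _ => hN e
    _ ≤ 3 * (3 * n) := Nat.mul_le_mul_right _ Finset.card_le_three
    _ = 9 * n := by ring

/-- The expectation of the least cost of a triplet, in terms of its edge probabilities. -/
def meanMinCost (a b c : ℝ) : ℝ := a * b + a * c + b * c - a * b * c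

lemma minTripletCost_eq_meanMinCost {V : Type} {w : V → V → ℝ} {i j k : V}
    (h1 : w i j = 0 ∨ w i j = 1) (h2 : w i k = 0 ∨ w i k = 1) (h3 : w j k = 0 ∨ w j k = 1) :
    minTripletCost w i j k = meanMinCost (w i j) (w i k) (w j k) := by
  unfold minTripletCost meanMinCost
  rcases h1 with h1 | h1 <;> rcases h2 with h2 | h2 <;> rcases h3 with h3 | h3 <;>
    norm_num [h1, h2, h3]

lemma unitWeight_eq_zero_or_one {V : Type} (G : SimpleGraph V) (i j : V) :
    unitWeight G i j = 0 ∨ unitWeight G i j = 1 := by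
  unfold unitWeight; split_ifs <;> simp

lemma minTripletCost_unitWeight_nonneg {V : Type} (G : SimpleGraph V) (i j k : V) :
    0 ≤ minTripletCost (unitWeight G) i j k := by
  unfold minTripletCost
  rcases unitWeight_eq_zero_or_one G i j with h1 | h1 <;>
    rcases unitWeight_eq_zero_or_one G i k with h2 | h2 <;>
    rcases unitWeight_eq_zero_or_one G j k with h3 | h3 <;> norm_num [h1, h2, h3]

lemma minTripletCost_unitWeight_le_two {V : Type} (G : SimpleGraph V) (i j k : V) :
    minTripletCost (unitWeight G) i j k ≤ 2 := by
  unfold minTripletCost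
  rcases unitWeight_eq_zero_or_one G i j with h1 | h1 <;>
    rcases unitWeight_eq_zero_or_one G i k with h2 | h2 <;>
    rcases unitWeight_eq_zero_or_one G j k with h3 | h3 <;> norm_num [h1, h2, h3]

lemma minTripletCost_graphOfPairs {n : ℕ} (ω : VertexPair n → Prop) {i j k : Fin n}
    (hij : i < j) (hjk : j < k) :
    minTripletCost (unitWeight (graphOfPairs ω)) i j k =
      meanMinCost (propInd (ω ⟨(i, j), hij⟩)) (propInd (ω ⟨(i, k), hij.trans hjk⟩))
        (propInd (ω ⟨(j, k), hjk⟩)) := by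
  rw [minTripletCost_eq_meanMinCost (unitWeight_eq_zero_or_one _ _ _)
    (unitWeight_eq_zero_or_one _ _ _) (unitWeight_eq_zero_or_one _ _ _),
    unitWeight_graphOfPairs ω hij, unitWeight_graphOfPairs ω hjk,
    unitWeight_graphOfPairs ω (hij.trans hjk)]

section BaseCostMoments

variable {n : ℕ} (P : Fin n → Fin n → I)

lemma integral_propInd_mul {e e' : VertexPair n} (h : e ≠ e') :
    ∫ ω, propInd (ω e) * propInd (ω e') ∂pairMeasure P =
      P e.1.1 e.1.2 * P e'.1.1 e'.1.2 := by
  have := ((iIndepFun_comp_eval P fun _ => propInd).indepFun h).integral_mul_eq_mul_integral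
    .of_discrete .of_discrete
  rw [← integral_propInd, ← integral_propInd]
  exact this

lemma integral_propInd_mul_mul {e e' e'' : VertexPair n} (h : e ≠ e') (h1 : e ≠ e'')
    (h2 : e' ≠ e'') :
    ∫ ω, propInd (ω e) * propInd (ω e') * propInd (ω e'') ∂pairMeasure P =
      P e.1.1 e.1.2 * P e'.1.1 e'.1.2 * P e''.1.1 e''.1.2 := by
  have := ((iIndepFun_comp_eval P fun _ => propInd).indepFun_mul_left
    (fun _ => .of_discrete) e e' e'' h1 h2).integral_mul_eq_mul_integral .of_discrete .of_discrete
  rw [← integral_propInd_mul P h, ← integral_propInd P e'']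
  exact this

lemma integral_minTripletCost {i j k : Fin n} (hij : i < j) (hjk : j < k) :
    ∫ ω, minTripletCost (unitWeight (graphOfPairs ω)) i j k ∂pairMeasure P =
      meanMinCost (P i j) (P i k) (P j k) := by
  simp only [minTripletCost_graphOfPairs _ hij hjk, meanMinCost]
  have h1 : (⟨(i, j), hij⟩ : VertexPair n) ≠ ⟨(i, k), hij.trans hjk⟩ := by simp [hjk.ne]
  have h2 : (⟨(i, j), hij⟩ : VertexPair n) ≠ ⟨(j, k), hjk⟩ := by simp [hij.ne]
  have h3 : (⟨(i, k), hij.trans hjk⟩ : VertexPair n) ≠ ⟨(j, k), hjk⟩ := by simp [hij.ne]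
  rw [integral_sub .of_finite .of_finite, integral_add .of_finite .of_finite,
    integral_add .of_finite .of_finite, integral_propInd_mul P h1, integral_propInd_mul P h2,
    integral_propInd_mul P h3, integral_propInd_mul_mul P h1 h2 h3]

lemma indepFun_minTripletCost {t t' : Fin n × Fin n × Fin n} (ht : t ∈ triplets n)
    (ht' : t' ∈ triplets n) (h : Disjoint (tripletPairs t) (tripletPairs t')) :
    IndepFun (fun ω => minTripletCost (unitWeight (graphOfPairs ω)) t.1 t.2.1 t.2.2)
      (fun ω => minTripletCost (unitWeight (graphOfPairs ω)) t'.1 t'.2.1 t'.2.2)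
      (pairMeasure P) := by
  let S : Fin n × Fin n × Fin n → Finset (VertexPair n) := fun t =>
    Finset.univ.filter fun e => e.1 ∈ tripletPairs t
  have hS : Disjoint (S t) (S t') := by
    refine Finset.disjoint_left.2 fun e he he' => ?_
    simp only [S, Finset.mem_filter, Finset.mem_univ, true_and] at he he'
    exact Finset.disjoint_left.1 h he he'
  have hfactor : ∀ t ∈ triplets n, ∃ φ : (S t → ℝ) → ℝ, Measurable φ ∧
      (fun ω => minTripletCost (unitWeight (graphOfPairs ω)) t.1 t.2.1 t.2.2) =
        φ ∘ fun ω (e : S t) => propInd (ω e) := by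
    rintro ⟨i, j, k⟩ ht
    simp only [triplets, Finset.mem_filter, Finset.mem_univ, true_and] at ht
    obtain ⟨hij, hjk⟩ := ht
    refine ⟨fun y => meanMinCost (y ⟨⟨(i, j), hij⟩, by simp [S, tripletPairs]⟩)
      (y ⟨⟨(i, k), hij.trans hjk⟩, by simp [S, tripletPairs]⟩)
      (y ⟨⟨(j, k), hjk⟩, by simp [S, tripletPairs]⟩), ?_, ?_⟩
    · unfold meanMinCost
      fun_prop
    · funext ω
      exact minTripletCost_graphOfPairs ω hij hjk
  obtain ⟨φ, hφ, h1⟩ := hfactor t ht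
  obtain ⟨φ', hφ', h2⟩ := hfactor t' ht'
  rw [h1, h2]
  exact ((iIndepFun_comp_eval P fun _ => propInd).indepFun_finset (S t) (S t') hS
    fun _ => .of_discrete).comp hφ hφ'

/-- The expectation of the base cost. -/
def meanBaseCost (P : Fin n → Fin n → I) : ℝ :=
  ∑ t ∈ triplets n, meanMinCost (P t.1 t.2.1) (P t.1 t.2.2) (P t.2.1 t.2.2)

lemma sum_integral_minTripletCost :
    ∑ t ∈ triplets n,
      ∫ ω, minTripletCost (unitWeight (graphOfPairs ω)) t.1 t.2.1 t.2.2 ∂pairMeasure P =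
      meanBaseCost P :=
  Finset.sum_congr rfl fun t ht => by
    simp only [triplets, Finset.mem_filter, Finset.mem_univ, true_and] at ht
    exact integral_minTripletCost P ht.1 ht.2

lemma integral_baseCost :
    ∫ ω, baseCost (unitWeight (graphOfPairs ω)) ∂pairMeasure P = meanBaseCost P := by
  simp only [baseCost]
  rw [integral_finsetSum _ fun _ _ => .of_finite, sum_integral_minTripletCost]

lemma variance_baseCost_le :
    Var[fun ω => baseCost (unitWeight (graphOfPairs ω)); pairMeasure P] ≤
      18 * n * meanBaseCost P := by
  have h := variance_sum_le_of_indep (μ := pairMeasure P) (triplets n)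
    (fun t ω => minTripletCost (unitWeight (graphOfPairs ω)) t.1 t.2.1 t.2.2)
    (fun t t' => ¬ Disjoint (tripletPairs t) (tripletPairs t')) (K := 9 * n) (b := 2)
    (fun _ => .of_discrete) (fun _ _ => minTripletCost_unitWeight_nonneg _ _ _ _)
    (fun _ _ => minTripletCost_unitWeight_le_two _ _ _ _)
    (fun t ht t' ht' h => indepFun_minTripletCost P ht ht' (not_not.1 h))
    (fun t _ => card_filter_not_disjoint_le _ t)
  rw [sum_integral_minTripletCost] at h
  refine h.trans_eq ?_
  push_cast
  ring

/-- Chebyshev's inequality for the base cost. -/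
lemma measureReal_le_abs_baseCost_sub_le (hpos : 0 < meanBaseCost P) {s : ℝ} (hs : 0 < s) :
    (pairMeasure P).real {ω | s * meanBaseCost P ≤
      |baseCost (unitWeight (graphOfPairs ω)) - meanBaseCost P|} ≤
      18 * n / (s ^ 2 * meanBaseCost P) := by
  have h := meas_ge_le_variance_div_sq (μ := pairMeasure P)
    (X := fun ω => baseCost (unitWeight (graphOfPairs ω))) .of_discrete (mul_pos hs hpos)
  rw [integral_baseCost] at h
  refine (ENNReal.toReal_mono ENNReal.ofReal_ne_top h).trans ?_
  rw [ENNReal.toReal_ofReal (div_nonneg (variance_nonneg _ _) (sq_nonneg _))]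
  calc _ ≤ 18 * n * meanBaseCost P / (s * meanBaseCost P) ^ 2 := by
        gcongr
        exact variance_baseCost_le P
    _ = 18 * n / (s ^ 2 * meanBaseCost P) := by field_simp

end BaseCostMoments

/-- Bounds for the optimal ratio cost from bounds for total and base costs. -/
lemma optRatioCost_bounds {n : ℕ} {w : Fin n → Fin n → ℝ} {N D e : ℝ} (hN : 0 < N) (hD : 0 < D)
    (he0 : 0 ≤ e) (he : e ≤ 1 / 2) (hlow : ∀ T, N * (1 - e) ≤ totalCost w T)
    {T₀ : HCTree (Fin n)} (hup : totalCost w T₀ ≤ N * (1 + e))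
    (hbase : |baseCost w - D| ≤ e * D) :
    (((1 - 4 * e) * (N / D) : ℝ) : EReal) ≤ optRatioCost w ∧
      optRatioCost w ≤ (((1 + 4 * e) * (N / D) : ℝ) : EReal) := by
  rw [abs_le] at hbase
  obtain ⟨hb1, hb2⟩ := hbase
  have hlb : (1 - e) * D ≤ baseCost w := by linarith
  have hub : baseCost w ≤ (1 + e) * D := by linarith
  have hpos : 0 < baseCost w := lt_of_lt_of_le (mul_pos (by linarith) hD) hlb
  have hratio (T : HCTree (Fin n)) :
      ratioCost w T = ((totalCost w T / baseCost w : ℝ) : EReal) := by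
    simp [ratioCost, hpos.ne']
  constructor
  · refine le_iInf fun T => ?_
    rw [hratio, EReal.coe_le_coe_iff, ← mul_div_assoc, div_le_div_iff₀ hD hpos]
    have h1 : (1 - 4 * e) * baseCost w ≤ (1 - e) * D := by
      rcases le_total 0 (1 - 4 * e) with h | h
      · nlinarith [mul_le_mul_of_nonneg_left hub h, mul_nonneg he0 hD.le,
          mul_nonneg (mul_nonneg he0 he0) hD.le]
      · exact (mul_nonpos_of_nonpos_of_nonneg h hpos.le).trans
          (mul_nonneg (by linarith) hD.le)
    calc (1 - 4 * e) * N * baseCost w = N * ((1 - 4 * e) * baseCost w) := by ring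
      _ ≤ N * ((1 - e) * D) := mul_le_mul_of_nonneg_left h1 hN.le
      _ = N * (1 - e) * D := by ring
      _ ≤ totalCost w T * D := mul_le_mul_of_nonneg_right (hlow T) hD.le
  · refine (iInf_le _ T₀).trans ?_
    rw [hratio, EReal.coe_le_coe_iff, ← mul_div_assoc, div_le_div_iff₀ hpos hD]
    have h1 : (1 + e) * D ≤ (1 + 4 * e) * baseCost w := by
      have h2 := mul_le_mul_of_nonneg_left hlb (by linarith : 0 ≤ 1 + 4 * e)
      have h3 : 0 ≤ e * (1 - 2 * e) * D :=
        mul_nonneg (mul_nonneg he0 (by linarith)) hD.le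
      nlinarith
    calc totalCost w T₀ * D ≤ N * (1 + e) * D := mul_le_mul_of_nonneg_right hup hD.le
      _ = N * ((1 + e) * D) := by ring
      _ ≤ N * ((1 + 4 * e) * baseCost w) := mul_le_mul_of_nonneg_left h1 hN.le
      _ = (1 + 4 * e) * N * baseCost w := by ring

lemma meanBaseCost_plantedBisection (n : ℕ) (p q : I) :
    meanBaseCost (plantedBisection n p q) = ∑ t ∈ triplets n,
      if SameHalf t then 3 * (p : ℝ) ^ 2 - (p : ℝ) ^ 3
      else (q : ℝ) ^ 2 + 2 * p * q - p * (q : ℝ) ^ 2 := by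
  refine Finset.sum_congr rfl fun t _ => ?_
  simp only [coe_plantedBisection]
  unfold meanMinCost plantedWeight SameHalf
  by_cases h1 : InFirstHalf t.1 <;> by_cases h2 : InFirstHalf t.2.1 <;>
    by_cases h3 : InFirstHalf t.2.2 <;> simp only [h1, h2, h3] <;> simp <;> ring

lemma abs_meanBaseCost_plantedBisection_sub_le {n : ℕ} (hn : 0 < n) (p q : I) :
    |meanBaseCost (plantedBisection n p q) -
      n ^ 3 / 24 * (3 * ((p : ℝ) + q) ^ 2 - (p : ℝ) ^ 3 - 3 * p * (q : ℝ) ^ 2)| ≤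
      24 / n * (n ^ 3 / 24 * (3 * ((p : ℝ) + q) ^ 2 - (p : ℝ) ^ 3 - 3 * p * (q : ℝ) ^ 2)) := by
  have hp0 : (0 : ℝ) ≤ p := p.2.1
  have hp1 : (p : ℝ) ≤ 1 := p.2.2
  have hq0 : (0 : ℝ) ≤ q := q.2.1
  have ha : 0 ≤ 3 * (p : ℝ) ^ 2 - (p : ℝ) ^ 3 := by
    have := mul_nonneg (sq_nonneg (p : ℝ)) (by linarith : 0 ≤ 3 - (p : ℝ))
    linarith
  have hb : 0 ≤ (q : ℝ) ^ 2 + 2 * p * q - p * (q : ℝ) ^ 2 := by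
    have := mul_nonneg (sq_nonneg (q : ℝ)) (by linarith : 0 ≤ 1 - (p : ℝ))
    have := mul_nonneg hp0 hq0
    linarith
  have h := abs_sum_triplets_sameHalf_sub_le hn ha hb
  rw [← meanBaseCost_plantedBisection, show 3 * (p : ℝ) ^ 2 - (p : ℝ) ^ 3 +
    3 * ((q : ℝ) ^ 2 + 2 * p * q - p * (q : ℝ) ^ 2) =
    3 * ((p : ℝ) + q) ^ 2 - (p : ℝ) ^ 3 - 3 * p * (q : ℝ) ^ 2 by ring] at h
  exact h

lemma abs_plantedCost_sub_le {n : ℕ} (hn : 0 < n) {p q : ℝ} (hp : 0 ≤ p) (hq : 0 ≤ q) :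
    |plantedCost n p q - n ^ 3 / 24 * (2 * p + 6 * q)| ≤
      24 / n * (n ^ 3 / 24 * (2 * p + 6 * q)) := by
  have h := abs_sum_triplets_sameHalf_sub_le hn (mul_nonneg zero_le_two hp)
    (mul_nonneg zero_le_two hq)
  rw [show 2 * p + 3 * (2 * q) = 2 * p + 6 * q by ring] at h
  exact h

/-- If the total costs are close to those for the edge probabilities and the base cost is close to
its mean, then the optimal ratio cost is close to `bisectionValue`. -/
lemma optRatioCost_bounds_of_close {n : ℕ} (hn : 0 < n) {p q : I} (hq : (0 : ℝ) < q)
    (hqp : (q : ℝ) < p) {w : Fin n → Fin n → ℝ} {a s : ℝ} (ha : 0 ≤ a) (hs : 0 ≤ s)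
    (hsmall : 12 * a + 24 / n + 2 * s ≤ 1 / 2)
    (htotal : ∀ T, |totalCost w T - totalCost (fun i j => (plantedBisection n p q i j : ℝ)) T| ≤
      4 * n ^ 3 * (a * q))
    (hbase : |baseCost w - meanBaseCost (plantedBisection n p q)| ≤
      s * meanBaseCost (plantedBisection n p q)) :
    (((1 - 4 * (12 * a + 24 / n + 2 * s)) * bisectionValue p q : ℝ) : EReal) ≤ optRatioCost w ∧
      optRatioCost w ≤
        (((1 + 4 * (12 * a + 24 / n + 2 * s)) * bisectionValue p q : ℝ) : EReal) := by
  have hn' : (0 : ℝ) < n := by exact_mod_cast hn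
  have hp : (0 : ℝ) < p := hq.trans hqp
  have hE := abs_meanBaseCost_plantedBisection_sub_le hn p q
  have hC := abs_plantedCost_sub_le hn hp.le hq.le
  have hD : 0 < (n : ℝ) ^ 3 / 24 *
      (3 * ((p : ℝ) + q) ^ 2 - (p : ℝ) ^ 3 - 3 * p * (q : ℝ) ^ 2) :=
    mul_pos (by positivity) (bisectionValue_denom_pos hp p.2.2 hq.le)
  have hN : 0 < (n : ℝ) ^ 3 / 24 * (2 * p + 6 * q) := by positivity
  have hr : (0 : ℝ) ≤ 24 / n := by positivity
  have hNa : 4 * (n : ℝ) ^ 3 * (a * q) ≤ 12 * a * ((n : ℝ) ^ 3 / 24 * (2 * p + 6 * q)) := by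
    have : 0 ≤ (n : ℝ) ^ 3 * a * (p - q) :=
      mul_nonneg (mul_nonneg (by positivity) ha) (sub_nonneg.2 hqp.le)
    linarith
  obtain ⟨T₀, hT₀⟩ := exists_hcTree_planted hn
  simp only [coe_plantedBisection] at htotal
  have hF : bisectionValue p q = ((n : ℝ) ^ 3 / 24 * (2 * p + 6 * q)) /
      ((n : ℝ) ^ 3 / 24 * (3 * ((p : ℝ) + q) ^ 2 - (p : ℝ) ^ 3 - 3 * p * (q : ℝ) ^ 2)) := by
    rw [mul_div_mul_left _ _ (by positivity)]
    rfl
  rw [hF]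
  set N : ℝ := (n : ℝ) ^ 3 / 24 * (2 * p + 6 * q)
  set D : ℝ := (n : ℝ) ^ 3 / 24 * (3 * ((p : ℝ) + q) ^ 2 - (p : ℝ) ^ 3 - 3 * p * (q : ℝ) ^ 2)
  set E := meanBaseCost (plantedBisection n p q)
  set r : ℝ := 24 / n
  rw [abs_le] at hE hC hbase
  have hsN : 0 ≤ s * N := mul_nonneg hs hN.le
  refine optRatioCost_bounds (T₀ := T₀) hN hD (by positivity) hsmall (fun T => ?_) ?_ ?_
  · have h1 := (abs_le.1 (htotal T)).1
    have h2 := plantedCost_le_totalCost hq.le hqp.le T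
    have h3 := hC.1
    linarith
  · have h1 := (abs_le.1 (htotal T₀)).2
    rw [hT₀] at h1
    have h3 := hC.2
    linarith
  · have hE2 : E ≤ 2 * D := by nlinarith [hE.2]
    have hsE : s * E ≤ s * (2 * D) := mul_le_mul_of_nonneg_left hE2 hs
    have haD : 0 ≤ a * D := mul_nonneg ha hD.le
    rw [abs_le]
    constructor <;> linarith [hE.1, hE.2, hbase.1, hbase.2]

lemma mul_exp_neg_two_mul_log {n : ℕ} (hn : 0 < n) :
    (n : ℝ) ^ n * (2 * Real.exp (-(2 * n * Real.log n))) ≤ 2 / n := by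
  have hn' : (0 : ℝ) < n := by exact_mod_cast hn
  have h1 : (n : ℝ) ^ n = Real.exp (n * Real.log n) := by
    rw [Real.exp_nat_mul, Real.exp_log hn']
  have hlog : 0 ≤ Real.log n := Real.log_natCast_nonneg n
  calc (n : ℝ) ^ n * (2 * Real.exp (-(2 * n * Real.log n)))
      = 2 * Real.exp (-(n * Real.log n)) := by
        rw [h1, mul_left_comm, ← Real.exp_add]
        ring_nf
    _ ≤ 2 * Real.exp (-Real.log n) := by
        gcongr
        have : (1 : ℝ) ≤ n := by exact_mod_cast hn
        nlinarith
    _ = 2 / n := by rw [Real.exp_neg, Real.exp_log hn']; rfl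

/-- A lower bound for the expected base cost of the planted bisection model. -/
lemma sq_mul_log_le_meanBaseCost {n : ℕ} (hn : 48 ≤ n) {p q : I} (hqp : (q : ℝ) < p)
    (hlog : Real.log n ≤ n * (q : ℝ) ^ 2) :
    (n : ℝ) ^ 2 * Real.log n / 6 ≤ meanBaseCost (plantedBisection n p q) := by
  have hn' : (48 : ℝ) ≤ n := by exact_mod_cast hn
  have hq : (0 : ℝ) ≤ q := q.2.1
  have hp1 : (p : ℝ) ≤ 1 := p.2.2
  have hp : (0 : ℝ) < p := hq.trans_lt hqp
  have hE := (abs_le.1 (abs_meanBaseCost_plantedBisection_sub_le (n := n) (by omega) p q)).1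
  have hr : (24 : ℝ) / n ≤ 1 / 2 := by
    rw [div_le_div_iff₀ (by linarith) two_pos]
    linarith
  have hd : 8 * (q : ℝ) ^ 2 ≤ 3 * ((p : ℝ) + q) ^ 2 - (p : ℝ) ^ 3 - 3 * p * (q : ℝ) ^ 2 := by
    have h1 : 0 ≤ (p : ℝ) ^ 2 * (1 - p) := mul_nonneg (sq_nonneg _) (by linarith)
    have h2 : 0 ≤ (q : ℝ) ^ 2 * (1 - p) := mul_nonneg (sq_nonneg _) (by linarith)
    nlinarith [mul_nonneg hq (sub_nonneg.2 hqp.le)]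
  set d : ℝ := 3 * ((p : ℝ) + q) ^ 2 - (p : ℝ) ^ 3 - 3 * p * (q : ℝ) ^ 2
  have hD : (n : ℝ) ^ 3 / 24 * (8 * (q : ℝ) ^ 2) ≤ (n : ℝ) ^ 3 / 24 * d :=
    mul_le_mul_of_nonneg_left hd (by positivity)
  have hD0 : 0 ≤ (n : ℝ) ^ 3 / 24 * d := le_trans (by positivity) hD
  have h3 := mul_le_mul_of_nonneg_right hr hD0
  have h4 := mul_le_mul_of_nonneg_left hlog (sq_nonneg (n : ℝ))
  nlinarith

/-- Quantitative concentration of the optimal ratio cost in the planted bisection model. -/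
lemma one_sub_lt_measureReal_optRatioCost {n : ℕ} (hn : 48 ≤ n) {p q : I} (hq : (0 : ℝ) < q)
    (hqp : (q : ℝ) < p) {a s : ℝ} (ha : a = Real.sqrt (Real.log n / n) / q) (ha1 : a ≤ 1)
    (hs : s = (n : ℝ) ^ (-(1 / 4) : ℝ)) (hs1 : s < 1 / 200)
    (hsmall : 12 * a + 24 / n + 2 * s ≤ 1 / 2) :
    1 - s < (randomGraph (plantedBisection n p q)).real
      {G | (((1 - 4 * (12 * a + 24 / n + 2 * s)) * bisectionValue p q : ℝ) : EReal)
              ≤ optRatioCost (unitWeight G) ∧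
            optRatioCost (unitWeight G)
              ≤ (((1 + 4 * (12 * a + 24 / n + 2 * s)) * bisectionValue p q : ℝ) : EReal)} := by
  have hn48 : (48 : ℝ) ≤ n := by exact_mod_cast hn
  have hn' : (0 : ℝ) < n := by linarith
  have hlog1 : 1 ≤ Real.log n := by
    rw [Real.le_log_iff_exp_le hn']
    linarith [Real.exp_one_lt_three]
  have hs0 : 0 < s := hs ▸ Real.rpow_pos_of_pos hn' _
  have hs4 : s ^ 4 = 1 / n := by
    rw [hs, ← Real.rpow_natCast, ← Real.rpow_mul hn'.le]
    norm_num [Real.rpow_neg_one]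
  have ha0 : 0 ≤ a := by rw [ha]; positivity
  have haq : a * q = Real.sqrt (Real.log n / n) := by rw [ha]; field_simp
  have haq2 : n * (a * q) ^ 2 = Real.log n := by
    rw [haq, Real.sq_sqrt (by positivity)]
    field_simp
  have hlogq : Real.log n ≤ n * (q : ℝ) ^ 2 := by
    rw [← haq2]
    gcongr
    exact mul_le_of_le_one_left hq.le ha1
  set P := plantedBisection n p q
  have hE := sq_mul_log_le_meanBaseCost hn hqp hlogq
  have hE' : (n : ℝ) ^ 2 / 6 ≤ meanBaseCost P := by
    refine le_trans ?_ hE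
    gcongr
    exact le_mul_of_one_le_right (by positivity) hlog1
  have hEpos : 0 < meanBaseCost P := lt_of_lt_of_le (by positivity) hE'
  have hA := measureReal_exists_lt_abs_totalCost_le P (by omega) (t := 2 * n ^ 2 * (a * q))
    (by positivity)
  have hexp : -(2 * (n : ℝ) ^ 2 * (a * q)) ^ 2 / (2 * n ^ 2) = -(2 * n * Real.log n) := by
    rw [← haq2]
    field_simp
  rw [hexp] at hA
  replace hA := hA.trans (mul_exp_neg_two_mul_log (by omega))
  have hB := measureReal_le_abs_baseCost_sub_le P hEpos hs0
  have hB' : 18 * n / (s ^ 2 * meanBaseCost P) ≤ 108 * s ^ 2 := by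
    rw [div_le_iff₀ (by positivity)]
    calc 18 * (n : ℝ) = 108 * s ^ 4 * (n ^ 2 / 6) := by rw [hs4]; field_simp; norm_num
      _ ≤ 108 * s ^ 4 * meanBaseCost P := by gcongr
      _ = 108 * s ^ 2 * (s ^ 2 * meanBaseCost P) := by ring
  replace hB := hB.trans hB'
  set A : Set (VertexPair n → Prop) := {ω | ∃ T : HCTree (Fin n), 2 * n * (2 * n ^ 2 * (a * q)) <
      |totalCost (unitWeight (graphOfPairs ω)) T - totalCost (fun i j => (P i j : ℝ)) T|}
  set B : Set (VertexPair n → Prop) := {ω | s * meanBaseCost P ≤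
      |baseCost (unitWeight (graphOfPairs ω)) - meanBaseCost P|}
  set S : Set (SimpleGraph (Fin n)) := {G |
    (((1 - 4 * (12 * a + 24 / n + 2 * s)) * bisectionValue p q : ℝ) : EReal)
        ≤ optRatioCost (unitWeight G) ∧
      optRatioCost (unitWeight G)
        ≤ (((1 + 4 * (12 * a + 24 / n + 2 * s)) * bisectionValue p q : ℝ) : EReal)}
  have hsub : (A ∪ B)ᶜ ⊆ graphOfPairs ⁻¹' S := by
    intro ω hω
    rw [Set.compl_union] at hω
    obtain ⟨hωA, hωB⟩ := hω
    simp only [A, B, Set.mem_compl_iff, Set.mem_ofPred_eq, not_exists, not_lt, not_le] at hωA hωB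
    refine optRatioCost_bounds_of_close (by omega) hq hqp ha0 hs0.le hsmall (fun T => ?_) hωB.le
    exact (hωA T).trans_eq (by ring)
  have hAB : (pairMeasure P).real (A ∪ B) ≤ 2 / n + 108 * s ^ 2 :=
    (measureReal_union_le _ _).trans (add_le_add hA hB)
  have hcompl : (pairMeasure P).real (A ∪ B)ᶜ = 1 - (pairMeasure P).real (A ∪ B) :=
    probReal_compl_eq_one_sub .of_discrete
  have hmap : (pairMeasure P).real (graphOfPairs ⁻¹' S) ≤ (randomGraph P).real S :=
    ENNReal.toReal_mono (measure_ne_top _ _)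
      (Measure.le_map_apply measurable_graphOfPairs.aemeasurable S)
  have hfail : 2 / n + 108 * s ^ 2 < s := by
    have h1 : (2 : ℝ) / n = 2 * s ^ 4 := by rw [hs4]; ring
    rw [h1]
    have h2 : s ^ 2 ≤ s * (1 / 200) := by nlinarith
    have h3 : s ^ 4 ≤ s ^ 2 := by nlinarith [sq_nonneg s]
    linarith
  have := measureReal_mono (μ := pairMeasure P) hsub
  linarith

theorem mainTheorem8 :
    (∃ ε : ℝ, 0 < ε ∧ ∀ p q : ℕ → unitInterval,
      (∀ n, q n < p n) →
      (fun n : ℕ => Real.sqrt (Real.log n / n)) =o[atTop] (fun n : ℕ => (q n : ℝ)) →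
      ∃ δ : ℕ → ℝ, Tendsto δ atTop (𝓝 0) ∧
        ∀ᶠ n : ℕ in atTop,
          1 - (n : ℝ) ^ (-ε) <
            (randomGraph (plantedBisection n (p n) (q n))).real
              {G | (((1 - δ n) * bisectionValue (p n) (q n) : ℝ) : EReal)
                      ≤ optRatioCost (unitWeight G) ∧
                    optRatioCost (unitWeight G)
                      ≤ (((1 + δ n) * bisectionValue (p n) (q n) : ℝ) : EReal)}) ∧
    (∀ q : ℝ, 0 ≤ q → q < 1 →
      StrictAntiOn (fun p => bisectionValue p q) (Set.Ioc q 1)) ∧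
    (∀ p : ℝ, 0 < p → p < 1 →
      StrictMonoOn (fun q => bisectionValue p q) (Set.Ico 0 (p / 3)) ∧
      StrictAntiOn (fun q => bisectionValue p q) (Set.Ico (p / 3) p)) ∧
    (∀ q : ℝ, 0 ≤ q → q < 1 → bisectionValue 1 q = 1) := by
  refine ⟨⟨1 / 4, by norm_num, fun p q hqp hq => ?_⟩,
    fun q hq _ => bisectionValue_strictAntiOn_left hq,
    fun p hp hp1 => ⟨bisectionValue_strictMonoOn_right hp hp1,
      bisectionValue_strictAntiOn_right hp hp1⟩,
    fun q hq _ => bisectionValue_one hq⟩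
  let a : ℕ → ℝ := fun n => Real.sqrt (Real.log n / n) / q n
  let s : ℕ → ℝ := fun n => (n : ℝ) ^ (-(1 / 4) : ℝ)
  let e : ℕ → ℝ := fun n => 12 * a n + 24 / n + 2 * s n
  have ha : Tendsto a atTop (𝓝 0) := hq.tendsto_div_nhds_zero
  have hs : Tendsto s atTop (𝓝 0) :=
    (tendsto_rpow_neg_atTop (by norm_num : (0 : ℝ) < 1 / 4)).comp tendsto_natCast_atTop_atTop
  have he : Tendsto e atTop (𝓝 0) := by
    have h := ((ha.const_mul 12).add (tendsto_const_div_atTop_nhds_zero_nat (24 : ℝ))).add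
      (hs.const_mul 2)
    simpa using h
  refine ⟨fun n => 4 * e n, by simpa using he.const_mul 4, ?_⟩
  filter_upwards [eventually_ge_atTop 48, ha.eventually_le_const one_pos,
    hs.eventually_lt_const (by norm_num : (0 : ℝ) < 1 / 200),
    he.eventually_le_const (by norm_num : (0 : ℝ) < 1 / 2),
    hq.bound one_pos] with n hn ha1 hs1 he1 hbound
  have hq0 : (0 : ℝ) < q n := by
    have hn' : (48 : ℝ) ≤ n := by exact_mod_cast hn
    have h1 : 0 < Real.sqrt (Real.log n / n) :=
      Real.sqrt_pos.2 (div_pos (Real.log_pos (by linarith)) (by linarith))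
    rw [Real.norm_of_nonneg h1.le, Real.norm_of_nonneg (q n).2.1, one_mul] at hbound
    exact h1.trans_le hbound
  exact one_sub_lt_measureReal_optRatioCost hn hq0 (by exact_mod_cast hqp n) rfl ha1 rfl hs1 he1
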